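/- Let $p\in(0,1)$ and let $(X_i)_{i\ge 1}$ be the Markov chain with states $0$ and $1$, transition matrix $\begin{pmatrix} p & 1-p\\ 1 & 0\end{pmatrix}$ (rows and columns indexed by $0,1$) and initial probabilities $P(X_1=0)=\frac{1}{2-p}$, $P(X_1=1)=\frac{1-p}{2-p}$. For $\beta_0,\beta_1\in(0,1)$ let $\mu_{\beta_0,\beta_1,p}$ be the distribution on $\mathbb{R}$ of the random series $$S=\sum_{i=1}^{\infty}X_i\,\beta_1^{\hat X_i}\,\beta_0^{\,i-\hat X_i},\qquad \hat X_i=\sum_{k=1}^{i}X_k .$$ **Theorem.** Let $p\in(0,1)$, $q\in(1,2]$ and $c\in(0,1]$. Then for Lebesgue-almost every $\beta\in(0,0.739)$ satisfying $$\frac{p^{q}}{\beta^{q-1}}+\frac{(1-p)^{q}}{(c\beta^{2})^{q-1}}<1,$$ the measure $\mu_{\beta,c\beta,p}$ is absolutely continuous with respect to Lebesgue measure, and its density belongs to $L^{q}(\mathbb{R})$. -/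

import Mathlib

open MeasureTheory

/-- A (time-homogeneous) Markov chain `X 0, X 1, …` on a finite state space `σ`, with initial
probabilities `ι` and transition matrix `M`. The transition rule is the Markov property
`P(X (n+1) = s (n+1) | X 0 = s 0, …, X n = s n) = M (s n) (s (n+1))`, with the conditional
probability multiplied out. -/
structure IsMarkovChain {Ω σ : Type*} [MeasurableSpace Ω] [MeasurableSpace σ]
    (ι : σ → ℝ) (M : Matrix σ σ ℝ) (P : Measure Ω) (X : ℕ → Ω → σ) : Prop where
  measurable : ∀ n, Measurable (X n)
  initial : ∀ a, P.real {ω | X 0 ω = a} = ι a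
  transition : ∀ (n : ℕ) (s : ℕ → σ),
    P.real {ω | ∀ k ≤ n + 1, X k ω = s k} =
      P.real {ω | ∀ k ≤ n, X k ω = s k} * M (s n) (s (n + 1))

/-- The transition matrix with rows `(p, 1 - p)` and `(1, 0)`. -/
noncomputable def transitionMatrix (p : ℝ) : Matrix (Fin 2) (Fin 2) ℝ :=
  !![p, 1 - p; 1, 0]

/-- The initial probabilities `(1 / (2 - p), (1 - p) / (2 - p))`. -/
noncomputable def initialProb (p : ℝ) : Fin 2 → ℝ :=
  ![1 / (2 - p), (1 - p) / (2 - p)]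

/-- The number of ones among the first `n` entries of a zero-one sequence. -/
def countOnes (s : ℕ → Fin 2) (n : ℕ) : ℕ :=
  ∑ k ∈ Finset.range n, (s k : ℕ)

/-- The series `∑_{i ≥ 1} s_i β₁ ^ #_i(s) β₀ ^ (i - #_i(s))`, where `#_i(s) = s_1 + ⋯ + s_i`.
Sequences are indexed from zero here, so that `s_i` is `s (i - 1)`. -/
noncomputable def codingMap (β₀ β₁ : ℝ) (s : ℕ → Fin 2) : ℝ :=
  ∑' i : ℕ, ((s i : ℕ) : ℝ) * β₁ ^ countOnes s (i + 1) * β₀ ^ (i + 1 - countOnes s (i + 1))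

/-- The nonuniform Markov geometric measure: the distribution of the random series
`∑_{i ≥ 1} X_i β₁ ^ #_i(X) β₀ ^ (i - #_i(X))`. -/
noncomputable def markovGeometricMeasure {Ω : Type*} [MeasurableSpace Ω] (P : Measure Ω)
    (X : ℕ → Ω → Fin 2) (β₀ β₁ : ℝ) : Measure ℝ :=
  P.map (fun ω => codingMap β₀ β₁ (fun n => X n ω))

/-! The measure is the image of the Markov measure `m` on zero-one sequences under the coding map.
With `α = q - 1`, a local energy bound is averaged over `β` in an interval `(a, 0.739)`: if the
integral of `m {t | |F β s - F β t| ≤ r} ^ α` over `s` and `β` is `O(r ^ α)`, then Fatou's lemma and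
differentiation of measures give a density in `L ^ (α + 1)` for almost every `β`
(`ae_absolutelyContinuous_of_energy_bound`).

To bound the energy, sort `t` by the first time `n` at which it differs from `s`. Since `α ≤ 1`, the
power is subadditive, and Jensen and Fubini reduce matters to the length of the set of `β` with `|F
β s - F β t| ≤ r` (`lintegral_energy_le`). The difference is `c ^ (K + 1) * β ^ (n + 1)`, where `K`
counts the common ones, times a difference of power series whose coefficients are sparse because
ones are never adjacent. Transversality (`sparse_tsum_sub_ge`): divided by `t ^ 5`, such a series
decreases at a definite rate on `(0, 0.739]`, so it is small only on a short set. The bound `0.739`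
enters here.

What remains is the sum over words `u` of `m[u] ^ q * (c ^ #u * a ^ n) ^ (-α)`, where `#u` is the
number of ones in `u`. A two-state transfer recursion has coefficients equal to the two terms of the
hypothesis, so it converges when they sum to less than one (`summable_wordSum`). Rational `a` just
below `β` finish the proof. -/

/-! ### A transversality estimate for power series -/

/-- For `s ≤ t`, the increment of `x ↦ x ^ m` is controlled by the decrement of `x ↦ x ^ (-5)`. -/
lemma pow_sub_pow_le_inv_pow_sub {s t : ℝ} (hs : 0 < s) (hst : s ≤ t) (m : ℕ) :
    t ^ m - s ^ m ≤ m / 5 * t ^ (m + 5) * (1 / s ^ 5 - 1 / t ^ 5) := by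
  have ht : 0 < t := hs.trans_le hst
  -- Scaling by `w = s / t` leaves two comparisons with `1 - w`: Bernoulli for `1 - w ^ m`, and `5 *
  -- (1 - w) ≤ w ^ (-5) - 1`.
  obtain ⟨w, rfl⟩ : ∃ w, s = t * w := ⟨s / t, by field_simp⟩
  have hw : 0 < w := pos_of_mul_pos_right hs ht.le
  have hw1 : w ≤ 1 := by nlinarith
  have h1 : 1 + (m : ℝ) * (w - 1) ≤ w ^ m := by
    have := one_add_mul_le_pow (a := w - 1) (by linarith) m
    simpa using this
  have h2 : 5 * (1 - w) ≤ 1 / w ^ 5 - 1 := by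
    rw [le_sub_iff_add_le, le_div_iff₀ (by positivity)]
    nlinarith [pow_pos hw 5, pow_pos hw 4, pow_pos hw 3, pow_pos hw 2, sq_nonneg (w - 1),
      mul_nonneg (pow_pos hw 4).le (sq_nonneg (w - 1)), mul_nonneg (pow_pos hw 3).le
      (sq_nonneg (w - 1)), mul_nonneg (pow_pos hw 2).le (sq_nonneg (w - 1)),
      mul_nonneg hw.le (sq_nonneg (w - 1))]
  have e : (m : ℝ) / 5 * t ^ (m + 5) * (1 / (t * w) ^ 5 - 1 / t ^ 5)
      = t ^ m * (m / 5 * (1 / w ^ 5 - 1)) := by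
    rw [pow_add]
    field_simp
  rw [e, mul_pow, ← mul_one_sub]
  gcongr
  have : (m : ℝ) * (5 * (1 - w)) ≤ m * (1 / w ^ 5 - 1) := by gcongr
  linarith

/-- The decrement of `x ↦ x ^ (-m)` for `m ≤ 5` is controlled by that of `x ↦ x ^ (-5)`. -/
lemma inv_pow_sub_le_inv_pow_sub {s t : ℝ} (hs : 0 < s) (hst : s ≤ t) {m : ℕ} (hm : m ≤ 5) :
    1 / s ^ m - 1 / t ^ m ≤ m / 5 * t ^ (5 - m) * (1 / s ^ 5 - 1 / t ^ 5) := by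
  have ht : 0 < t := hs.trans_le hst
  obtain ⟨v, hv⟩ : ∃ v, v = t / s := ⟨_, rfl⟩
  have hv1 : 0 ≤ v - 1 := by rw [hv, sub_nonneg, le_div_iff₀ hs]; linarith
  have e1 : ∀ k : ℕ, 1 / s ^ k - 1 / t ^ k = (v ^ k - 1) / t ^ k := by
    intro k; rw [hv, div_pow]; field_simp
  have e2 : (m : ℝ) / 5 * t ^ (5 - m) * ((v ^ 5 - 1) / t ^ 5) = (m / 5 * (v ^ 5 - 1)) / t ^ m := by
    have : t ^ 5 = t ^ (5 - m) * t ^ m := by rw [← pow_add]; congr 1; omega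
    rw [this]; field_simp
  rw [e1, e1, e2]
  gcongr
  -- In powers of `u` the inequality holds coefficientwise: `C(m, k) ≤ m / 5 * C(5, k)` for `k ≥ 1`.
  obtain ⟨u, rfl⟩ : ∃ u, v = 1 + u := ⟨v - 1, by ring⟩
  have hu : 0 ≤ u := by linarith
  interval_cases m <;> norm_num <;>
    nlinarith [pow_nonneg hu 2, pow_nonneg hu 3, pow_nonneg hu 4, pow_nonneg hu 5]

/-- Coefficient sequences in `[0, 1]` whose neighbouring terms have sum at most one. -/
structure IsSparse (x : ℕ → ℝ) : Prop where
  nonneg : ∀ i, 0 ≤ x i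
  add_le : ∀ i, x i + x (i + 1) ≤ 1

lemma IsSparse.le_one {x : ℕ → ℝ} (hx : IsSparse x) (i : ℕ) : x i ≤ 1 := by
  linarith [hx.add_le i, hx.nonneg (i + 1)]

/-- The extremal value of the head of the power series, for the ratio `0.739`. -/
lemma IsSparse.head_le {y : ℕ → ℝ} (hy : IsSparse y) :
    ∑ i ∈ Finset.range 6, (5 - i : ℝ) * 0.739 ^ i * y i - 5 * y 0 ≤ 3.7632 := by
  have h := hy.nonneg
  have h' := hy.add_le
  simp only [Finset.sum_range_succ, Finset.sum_range_zero]
  norm_num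
  -- A small linear program, with optimum at `y 1 = y 3 = 1`.
  linarith [h 1, h 2, h 3, h 4, h' 1, h' 2, h' 3]

/-- The extremal value of the tail of the power series, for the ratio `0.739`. -/
lemma IsSparse.tail_le {x : ℕ → ℝ} (hx : IsSparse x) (n : ℕ) :
    ∑ j ∈ Finset.range (11 + 2 * n), (j : ℝ) * 0.739 ^ (5 + j) * x (5 + j) ≤ 1.2230 := by
  have h := hx.nonneg
  have h' := hx.add_le
  -- `B` is the full sum of `(11 + 2k) * 0.739 ^ (2k)`, and `(A * n + B) * 0.739 ^ (2n)` is its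
  -- remainder after `n` terms. From index 16 on, coefficients are paired and each pair is bounded
  -- by its first weight.
  obtain ⟨A, hA⟩ : ∃ A : ℝ, A = 2 / (1 - 0.739 ^ 2) := ⟨_, rfl⟩
  obtain ⟨B, hB⟩ : ∃ B : ℝ, B = (11 + 0.739 ^ 2 * A) / (1 - 0.739 ^ 2) := ⟨_, rfl⟩
  have hAB : 0 ≤ A ∧ 0 ≤ B := by rw [hB, hA]; norm_num
  have key : ∀ n : ℕ, ∑ j ∈ Finset.range (11 + 2 * n), (j : ℝ) * 0.739 ^ (5 + j) * x (5 + j)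
      ≤ ∑ j ∈ Finset.range 11, (j : ℝ) * 0.739 ^ (5 + j) * x (5 + j)
        + (B - (A * n + B) * 0.739 ^ (2 * n)) * 0.739 ^ 16 := by
    intro n
    induction n with
    | zero => simp
    | succ n ih =>
      rw [show 11 + 2 * (n + 1) = 11 + 2 * n + 1 + 1 by ring, Finset.sum_range_succ,
        Finset.sum_range_succ]
      have h1 := h (16 + 2 * n)
      have h2 := h (16 + 2 * n + 1)
      have h3 := h' (16 + 2 * n)
      have hb : (0 : ℝ) < 0.739 ^ (16 + 2 * n) := by positivity
      have e1 : ((11 + 2 * n + 1 : ℕ) : ℝ) * 0.739 ^ (5 + (11 + 2 * n + 1)) * x (5 + (11 + 2 * n + 1))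
          ≤ (11 + 2 * n) * 0.739 ^ (16 + 2 * n) * x (16 + 2 * n + 1) := by
        rw [show 5 + (11 + 2 * n + 1) = 16 + 2 * n + 1 by ring, pow_succ]
        have : ((11 + 2 * n + 1 : ℕ) : ℝ) * 0.739 ≤ 11 + 2 * n := by
          push_cast; linarith [(n.cast_nonneg : (0 : ℝ) ≤ n)]
        have h4 := mul_le_mul_of_nonneg_right this (mul_nonneg hb.le h2)
        linarith
      have e2 : ((11 + 2 * n : ℕ) : ℝ) * 0.739 ^ (5 + (11 + 2 * n)) * x (5 + (11 + 2 * n))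
          = (11 + 2 * n) * 0.739 ^ (16 + 2 * n) * x (16 + 2 * n) := by
        rw [show 5 + (11 + 2 * n) = 16 + 2 * n by ring]; push_cast; ring
      have e3 : (11 + 2 * n) * (0.739 : ℝ) ^ (16 + 2 * n) * (x (16 + 2 * n) + x (16 + 2 * n + 1))
          ≤ (11 + 2 * n) * 0.739 ^ (16 + 2 * n) * 1 := by gcongr
      have e4 : (B - (A * (n + 1 : ℕ) + B) * 0.739 ^ (2 * (n + 1))) * 0.739 ^ 16
          - (B - (A * n + B) * 0.739 ^ (2 * n)) * 0.739 ^ 16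
          = (11 + 2 * n) * (0.739 : ℝ) ^ (16 + 2 * n) := by
        rw [show 2 * (n + 1) = 2 * n + 2 by ring, pow_add, pow_add, hB, hA]
        push_cast
        ring
      linarith
  refine (key n).trans ?_
  have h1 : 0 ≤ (A * n + B) * 0.739 ^ (2 * n) * 0.739 ^ 16 := by
    have := hAB.1; have := hAB.2; positivity
  have h2 : B * 0.739 ^ 16 ≤ 0.2340 := by rw [hB, hA]; norm_num
  have h3 : ∑ j ∈ Finset.range 11, (j : ℝ) * 0.739 ^ (5 + j) * x (5 + j) ≤ 0.9888 := by
    simp only [Finset.sum_range_succ, Finset.sum_range_zero]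
    norm_num
    linarith [h 6, h 7, h 8, h 9, h 10, h 11, h 12, h 13, h 14, h 15, h' 6, h' 7, h' 8, h' 9,
      h' 10, h' 11, h' 12, h' 13, h' 14]
  linarith

/-- Transversality for the partial sums of the normalised power series. -/
lemma sparse_partial_sum_sub_ge {x y : ℕ → ℝ} (hx : IsSparse x) (hy : IsSparse y)
    (hx0 : x 0 = 1) (hy0 : y 0 = 0) {s t : ℝ} (hs : 0 < s) (hst : s ≤ t) (ht : t ≤ 0.739) (n : ℕ) :
    0.0027 * (1 / s ^ 5 - 1 / t ^ 5) ≤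
      ∑ i ∈ Finset.range (16 + 2 * n), (x i - y i) * (s ^ i / s ^ 5 - t ^ i / t ^ 5) := by
  have ht0 : 0 < t := hs.trans_le hst
  obtain ⟨Δ, hΔ⟩ : ∃ Δ, Δ = 1 / s ^ 5 - 1 / t ^ 5 := ⟨_, rfl⟩
  have hΔ0 : 0 ≤ Δ := by
    rw [hΔ, sub_nonneg]
    gcongr
  rw [← hΔ]
  -- Below index 5 the normalised powers decrease, so only `y` can hurt; from index 5 on they are
  -- nondecreasing, so only `x` can. The term `i = 0` supplies the gain `Δ`.
  have hlow : ∀ i ∈ Finset.range 5,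
      (if i = 0 then Δ else 0) - Δ / 5 * ((5 - i : ℝ) * 0.739 ^ i * y i)
      ≤ (x i - y i) * (s ^ i / s ^ 5 - t ^ i / t ^ 5) := by
    intro i hi
    have hi5 : i < 5 := Finset.mem_range.1 hi
    by_cases h0 : i = 0
    · subst h0
      simp [hx0, hy0, hΔ]
    have e : ∀ r : ℝ, 0 < r → r ^ i / r ^ 5 = 1 / r ^ (5 - i) := by
      intro r hr
      have : r ^ 5 = r ^ (5 - i) * r ^ i := by rw [← pow_add]; congr 1; omega
      rw [this]; field_simp
    rw [e s hs, e t ht0]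
    have h1 := inv_pow_sub_le_inv_pow_sub hs hst (m := 5 - i) (by omega)
    rw [← hΔ, show 5 - (5 - i) = i by omega, Nat.cast_sub hi5.le] at h1
    have h2 : 1 / t ^ (5 - i) ≤ 1 / s ^ (5 - i) := by gcongr
    have h3 : t ^ i ≤ 0.739 ^ i := by gcongr
    have h5 : (0 : ℝ) ≤ 5 - i := by
      have : (i : ℝ) < 5 := by exact_mod_cast hi5
      linarith
    have h4 : 1 / s ^ (5 - i) - 1 / t ^ (5 - i) ≤ Δ / 5 * ((5 - i : ℝ) * 0.739 ^ i) := by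
      refine h1.trans ?_
      have : (5 - i : ℝ) / 5 * t ^ i * Δ ≤ (5 - i : ℝ) / 5 * 0.739 ^ i * Δ := by gcongr
      push_cast
      linarith
    simp only [h0, if_false]
    nlinarith [mul_nonneg (hx.nonneg i) (sub_nonneg.2 h2),
      mul_le_mul_of_nonneg_right h4 (hy.nonneg i)]
  have hhigh : ∀ j, - (Δ / 5 * (j * 0.739 ^ (5 + j) * x (5 + j))) ≤
      (x (5 + j) - y (5 + j)) * (s ^ (5 + j) / s ^ 5 - t ^ (5 + j) / t ^ 5) := by
    intro j
    have e : ∀ r : ℝ, 0 < r → r ^ (5 + j) / r ^ 5 = r ^ j := by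
      intro r hr; rw [pow_add]; field_simp
    rw [e s hs, e t ht0]
    have h1 := pow_sub_pow_le_inv_pow_sub hs hst j
    rw [← hΔ] at h1
    have h2 : s ^ j ≤ t ^ j := by gcongr
    have h4 : t ^ j - s ^ j ≤ Δ / 5 * (j * 0.739 ^ (5 + j)) := by
      refine h1.trans ?_
      have : (j : ℝ) / 5 * t ^ (j + 5) * Δ ≤ j / 5 * 0.739 ^ (j + 5) * Δ := by gcongr
      rw [add_comm 5 j]
      linarith
    nlinarith [mul_nonneg (hy.nonneg (5 + j)) (sub_nonneg.2 h2),
      mul_le_mul_of_nonneg_right h4 (hx.nonneg (5 + j))]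
  have hsum := add_le_add (Finset.sum_le_sum hlow)
    (Finset.sum_le_sum fun j (_ : j ∈ Finset.range (11 + 2 * n)) => hhigh j)
  rw [show 16 + 2 * n = 5 + (11 + 2 * n) by ring, Finset.sum_range_add]
  refine le_trans ?_ hsum
  have h1 := hy.head_le
  have h2 := hx.tail_le n
  rw [Finset.sum_range_succ] at h1
  rw [Finset.sum_sub_distrib, ← Finset.mul_sum, Finset.sum_neg_distrib, ← Finset.mul_sum]
  simp only [Finset.sum_ite_eq', Finset.mem_range, Nat.ofNat_pos, if_true]
  rw [hy0] at h1
  norm_num at h1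
  have h3 : Δ / 5 * (∑ i ∈ Finset.range 5, (5 - i : ℝ) * 0.739 ^ i * y i)
    ≤ Δ / 5 * 3.7632 := by
    gcongr
    norm_num
    linarith
  have h4 := mul_le_mul_of_nonneg_left h2 (by positivity : 0 ≤ Δ / 5)
  -- The losses total `(3.7632 + 1.2230) / 5 * Δ`, which leaves more than `0.0027 * Δ`.
  linarith

lemma IsSparse.summable {x : ℕ → ℝ} (hx : IsSparse x) {r : ℝ} (hr : 0 ≤ r) (hr1 : r < 1) :
    Summable fun i => x i * r ^ i :=
  Summable.of_nonneg_of_le (fun i => mul_nonneg (hx.nonneg i) (by positivity))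
    (fun i => mul_le_of_le_one_left (by positivity) (hx.le_one i))
    (summable_geometric_of_lt_one hr hr1)

/-- Transversality: the normalised difference of two sparse power series decreases at a definite
rate on `(0, 0.739]`. -/
lemma sparse_tsum_sub_ge {x y : ℕ → ℝ} (hx : IsSparse x) (hy : IsSparse y)
    (hx0 : x 0 = 1) (hy0 : y 0 = 0) {s t : ℝ} (hs : 0 < s) (hst : s ≤ t) (ht : t ≤ 0.739) :
    0.0027 * (1 / s ^ 5 - 1 / t ^ 5) ≤
      (∑' i, (x i - y i) * s ^ i) / s ^ 5 - (∑' i, (x i - y i) * t ^ i) / t ^ 5 := by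
  have hsm : ∀ r : ℝ, 0 ≤ r → r < 1 → Summable fun i => (x i - y i) * r ^ i := by
    intro r h0 h1
    simpa only [sub_mul] using (hx.summable h0 h1).sub (hy.summable h0 h1)
  have hsum : HasSum (fun i => (x i - y i) * (s ^ i / s ^ 5 - t ^ i / t ^ 5))
      ((∑' i, (x i - y i) * s ^ i) / s ^ 5 - (∑' i, (x i - y i) * t ^ i) / t ^ 5) := by
    have h1 := (hsm s hs.le (by linarith)).hasSum.div_const (s ^ 5)
    have h2 := (hsm t (by linarith) (by linarith)).hasSum.div_const (t ^ 5)
    rw [show (fun i => (x i - y i) * (s ^ i / s ^ 5 - t ^ i / t ^ 5)) =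
      fun i => (x i - y i) * s ^ i / s ^ 5 - (x i - y i) * t ^ i / t ^ 5 from
      funext fun i => by ring]
    exact h1.sub h2
  have htend : Filter.Tendsto (fun n : ℕ => 16 + 2 * n) Filter.atTop Filter.atTop :=
    Filter.tendsto_atTop_mono (fun n => show n ≤ 16 + 2 * n by omega) Filter.tendsto_id
  exact ge_of_tendsto' (hsum.tendsto_sum_nat.comp htend)
    fun n => sparse_partial_sum_sub_ge hx hy hx0 hy0 hs hst ht n

/-- The set of parameters at which a difference of sparse series is small has small measure. -/
lemma volume_sparse_le {x y : ℕ → ℝ} (hx : IsSparse x) (hy : IsSparse y)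
    (hx0 : x 0 = 1) (hy0 : y 0 = 0) {a ρ : ℝ} (ha : 0 < a) (hρ : 0 ≤ ρ) :
    volume {t : ℝ | t ∈ Set.Ioo a 0.739 ∧ |∑' i, (x i - y i) * t ^ i| ≤ ρ} ≤
      ENNReal.ofReal (200 * ρ / a ^ 5) := by
  refine (Real.volume_le_diam _).trans (Metric.ediam_le fun s hs t ht => ?_)
  rw [edist_dist, Real.dist_eq]
  refine ENNReal.ofReal_le_ofReal ?_
  wlog hst : s ≤ t generalizing s t
  · rw [abs_sub_comm]; exact this t ht s hs (le_of_not_ge hst)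
  have hs0 : 0 < s := ha.trans hs.1.1
  have ht0 : 0 < t := ha.trans ht.1.1
  have key := sparse_tsum_sub_ge hx hy hx0 hy0 hs0 hst ht.1.2.le
  have hbd : ∀ r, a < r → ∀ g : ℝ, |g| ≤ ρ → |g / r ^ 5| ≤ ρ / a ^ 5 := by
    intro r hr g hg
    have : 0 < r := ha.trans hr
    rw [abs_div, abs_of_pos (pow_pos this 5)]
    gcongr
  have h1 := hbd s hs.1.1 _ hs.2
  have h2 := hbd t ht.1.1 _ ht.2
  have h4 : 5 * (t - s) ≤ 1 / s ^ 5 - 1 / t ^ 5 := by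
    have := pow_sub_pow_le_inv_pow_sub hs0 hst 1
    norm_num at this
    have h6 : t ^ 6 ≤ 1 := pow_le_one₀ ht0.le (by linarith [ht.1.2])
    have h7 : 0 ≤ 1 / s ^ 5 - 1 / t ^ 5 := by
      rw [sub_nonneg]
      gcongr
    norm_num at h7 ⊢
    nlinarith
  rw [abs_sub_comm, abs_of_nonneg (by linarith), mul_div_assoc]
  have h5 := (abs_le.1 h1).2
  have h6 := (abs_le.1 h2).1
  -- The rate is `5 * 0.0027 = 0.0135` and the values differ by at most `2ρ / a ^ 5`; `2 / 0.0135 <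
  -- 200`.
  nlinarith [h1, h2, h4, key, div_nonneg hρ (pow_pos ha 5).le]

/-! ### A differentiation criterion for absolute continuity -/

open Filter Topology ENNReal

/-- If the ball averages of `μ` are bounded along a sequence of radii in the `L^α(μ)` sense, then
`μ` is absolutely continuous with density in `L^{α + 1}`. -/
lemma absolutelyContinuous_of_lintegral_liminf {μ : Measure ℝ} [IsFiniteMeasure μ] {α : ℝ}
    (hα : 0 < α) {r : ℕ → ℝ} (hr : ∀ n, 0 < r n) (hr0 : Tendsto r atTop (𝓝 0))
    (h : ∫⁻ x, liminf (fun n => (μ (Metric.closedBall x (r n)) /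
      volume (Metric.closedBall x (r n))) ^ α) atTop ∂μ ≠ ∞) :
    μ ≪ volume ∧ ∫⁻ x, (μ.rnDeriv volume x) ^ (α + 1) ≠ ∞ := by
  have hr' : Tendsto r atTop (𝓝[>] 0) :=
    tendsto_nhdsWithin_iff.2 ⟨hr0, Eventually.of_forall fun n => hr n⟩
  have hvol : ∀ (x : ℝ) n, volume (Metric.closedBall x (r n)) ≠ 0 := fun x n => by
    simp [Real.volume_closedBall, hr n]
  -- Differentiating `volume` with respect to `μ` gives a limit `μ`-almost everywhere before
  -- absolute continuity is known. Finite energy keeps this derivative nonzero, so a Lebesgue-null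
  -- set must be `μ`-null.
  have hlim : ∀ᵐ x ∂μ, Tendsto (fun n => μ (Metric.closedBall x (r n)) /
      volume (Metric.closedBall x (r n))) atTop (𝓝 ((volume.rnDeriv μ x)⁻¹)) := by
    filter_upwards [Besicovitch.ae_tendsto_rnDeriv volume μ] with x hx
    have := (hx.comp hr').inv
    refine this.congr fun n => ?_
    exact ENNReal.inv_div (Or.inl (measure_ne_top _ _)) (Or.inr (hvol x n))
  have hne : ∀ᵐ x ∂μ, volume.rnDeriv μ x ≠ 0 := by
    have hmeas : AEMeasurable (fun x => ((volume.rnDeriv μ x)⁻¹) ^ α) μ :=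
      ((Measure.measurable_rnDeriv _ _).inv.pow_const _).aemeasurable
    have : ∀ᵐ x ∂μ, ((volume.rnDeriv μ x)⁻¹) ^ α < ∞ := by
      refine ae_lt_top' hmeas (ne_of_eq_of_ne (lintegral_congr_ae ?_) h)
      filter_upwards [hlim] with x hx
      exact (((ENNReal.continuous_rpow_const (y := α)).tendsto _).comp hx).liminf_eq.symm
    filter_upwards [this] with x hx h0
    simp [h0, ENNReal.top_rpow_of_pos hα] at hx
  have hac : μ ≪ volume := by
    refine Measure.AbsolutelyContinuous.mk fun s hs hs0 => ?_
    have h1 : ∫⁻ x in s, volume.rnDeriv μ x ∂μ = 0 :=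
      le_antisymm ((Measure.setLIntegral_rnDeriv_le s).trans hs0.le) zero_le
    rw [lintegral_eq_zero_iff (Measure.measurable_rnDeriv _ _)] at h1
    have h2 : ∀ᵐ x ∂(μ.restrict s), False := by
      filter_upwards [h1, ae_restrict_of_ae hne] with x hx hx'
      exact hx' hx
    simpa using h2
  refine ⟨hac, ?_⟩
  have hlim2 : ∀ᵐ x ∂μ, Tendsto (fun n => μ (Metric.closedBall x (r n)) /
      volume (Metric.closedBall x (r n))) atTop (𝓝 (μ.rnDeriv volume x)) :=
    hac (by
      filter_upwards [Besicovitch.ae_tendsto_rnDeriv μ volume] with x hx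
      exact hx.comp hr')
  have hint : ∫⁻ x, (μ.rnDeriv volume x) ^ α ∂μ ≠ ∞ := by
    refine ne_of_eq_of_ne (lintegral_congr_ae ?_) h
    filter_upwards [hlim2] with x hx
    exact (((ENNReal.continuous_rpow_const (y := α)).tendsto _).comp hx).liminf_eq.symm
  have hmeas := (Measure.measurable_rnDeriv μ volume)
  have hwd := Measure.withDensity_rnDeriv_eq μ volume hac
  have : ∫⁻ x, (μ.rnDeriv volume x) ^ α ∂μ = ∫⁻ x, (μ.rnDeriv volume x) ^ (α + 1) := by
    conv_lhs => rw [← hwd]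
    rw [lintegral_withDensity_eq_lintegral_mul _ hmeas (by rw [hwd]; exact hmeas.pow_const _)]
    refine lintegral_congr fun x => ?_
    rw [hwd, Pi.mul_apply, ENNReal.rpow_add_of_nonneg _ _ hα.le zero_le_one, ENNReal.rpow_one,
      mul_comm]
  rwa [← this]

/-- A countable version of the subadditivity of `x ↦ x ^ α` for `α ≤ 1`. -/
lemma ENNReal.tsum_rpow_le_tsum_rpow {ι : Type*} (f : ι → ℝ≥0∞) {α : ℝ} (hα : 0 < α)
    (hα1 : α ≤ 1) : (∑' i, f i) ^ α ≤ ∑' i, f i ^ α := by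
  have hfin : ∀ s : Finset ι, (∑ i ∈ s, f i) ^ α ≤ ∑ i ∈ s, f i ^ α := by
    classical
    intro s
    induction s using Finset.induction_on with
    | empty => simp [hα]
    | insert a s ha ih =>
      rw [Finset.sum_insert ha, Finset.sum_insert ha]
      exact (ENNReal.rpow_add_le_add_rpow _ _ hα.le hα1).trans (by gcongr)
  refine le_of_tendsto (((ENNReal.continuous_rpow_const (y := α)).tendsto _).comp
    (ENNReal.summable (f := f)).hasSum) (Eventually.of_forall fun s => ?_)
  exact (hfin s).trans (ENNReal.sum_le_tsum s)

/-- Jensen's inequality for `x ↦ x ^ α`, `α ≤ 1`, and a subprobability measure. -/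
lemma lintegral_rpow_le_rpow_lintegral {B : Type*} [MeasurableSpace B] {l : Measure B}
    (hl : l Set.univ ≤ 1) {f : B → ℝ≥0∞} (hf : Measurable f) {α : ℝ} (hα : 0 < α) (hα1 : α ≤ 1) :
    ∫⁻ b, f b ^ α ∂l ≤ (∫⁻ b, f b ∂l) ^ α := by
  have h := eLpNorm'_le_eLpNorm'_mul_rpow_measure_univ (μ := l) hα hα1
    (f := f) hf.aestronglyMeasurable
  simp only [eLpNorm', enorm_eq_self, ENNReal.rpow_one, div_one] at h
  have h1 : l Set.univ ^ (1 / α - 1) ≤ 1 :=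
    ENNReal.rpow_le_one hl (by rw [sub_nonneg]; exact one_le_one_div hα hα1)
  have h2 := h.trans (mul_le_of_le_one_right' h1)
  rw [one_div] at h2
  calc ∫⁻ b, f b ^ α ∂l = ((∫⁻ b, f b ^ α ∂l) ^ α⁻¹) ^ α := by
        rw [← ENNReal.rpow_mul, inv_mul_cancel₀ hα.ne', ENNReal.rpow_one]
    _ ≤ _ := by gcongr

/-- If the `α`-energies at scale `r` are uniformly bounded on average over the parameter, then
almost every image measure is absolutely continuous with density in `L^{α + 1}`. -/
lemma ae_absolutelyContinuous_of_energy_bound {B T : Type*} [MeasurableSpace B] [MeasurableSpace T]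
    {l : Measure B} [SFinite l] {m : Measure T} [IsFiniteMeasure m] {F : B → T → ℝ}
    (hF : Measurable (Function.uncurry F)) {α : ℝ} (hα : 0 < α) {r : ℕ → ℝ} (hr : ∀ n, 0 < r n)
    (hr0 : Tendsto r atTop (𝓝 0)) {C : ℝ≥0∞} (hC : C ≠ ∞)
    (h : ∀ n, ∫⁻ b, ∫⁻ s, m {t | |F b s - F b t| ≤ r n} ^ α ∂m ∂l ≤
      C * ENNReal.ofReal (2 * r n) ^ α) :
    ∀ᵐ b ∂l, m.map (F b) ≪ volume ∧ ∫⁻ x, ((m.map (F b)).rnDeriv volume x) ^ (α + 1) ≠ ∞ := by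
  have hFb : ∀ b, Measurable (F b) := fun b => hF.comp measurable_prodMk_left
  obtain ⟨Φ, hΦ⟩ : ∃ Φ : ℕ → B × T → ℝ≥0∞, Φ = fun n z =>
    (m {t | |F z.1 z.2 - F z.1 t| ≤ r n} / ENNReal.ofReal (2 * r n)) ^ α := ⟨_, rfl⟩
  have hΦm : ∀ n, Measurable (Φ n) := by
    intro n
    rw [hΦ]
    refine (Measurable.div_const ?_ _).pow_const _
    have hS : MeasurableSet {w : (B × T) × T | |F w.1.1 w.1.2 - F w.1.1 w.2| ≤ r n} := by
      refine measurableSet_le (Measurable.abs (Measurable.sub ?_ ?_)) measurable_const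
      · exact hF.comp measurable_fst
      · exact hF.comp ((measurable_fst.comp measurable_fst).prodMk measurable_snd)
    exact measurable_measure_prodMk_left hS
  have hbound : ∀ n, ∫⁻ b, ∫⁻ s, Φ n (b, s) ∂m ∂l ≤ C := by
    intro n
    have hpos : ENNReal.ofReal (2 * r n) ^ α ≠ 0 := by
      have := hr n
      simp [ENNReal.rpow_eq_zero_iff, this, hα.le]
    have htop : ENNReal.ofReal (2 * r n) ^ α ≠ ∞ :=
      ENNReal.rpow_ne_top_of_nonneg hα.le ENNReal.ofReal_ne_top
    calc ∫⁻ b, ∫⁻ s, Φ n (b, s) ∂m ∂l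
        = (∫⁻ b, ∫⁻ s, m {t | |F b s - F b t| ≤ r n} ^ α ∂m ∂l) *
          (ENNReal.ofReal (2 * r n) ^ α)⁻¹ := by
          simp only [hΦ, ENNReal.div_rpow_of_nonneg _ _ hα.le]
          simp only [div_eq_mul_inv]
          rw [← lintegral_mul_const' _ _ (ENNReal.inv_ne_top.2 hpos)]
          simp_rw [lintegral_mul_const' _ _ (ENNReal.inv_ne_top.2 hpos)]
      _ ≤ C * ENNReal.ofReal (2 * r n) ^ α * (ENNReal.ofReal (2 * r n) ^ α)⁻¹ := by
          gcongr; exact h n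
      _ = C := by rw [mul_assoc, ENNReal.mul_inv_cancel hpos htop, mul_one]
  have hfatou : ∫⁻ b, ∫⁻ s, liminf (fun n => Φ n (b, s)) atTop ∂m ∂l ≤ C := by
    calc _ ≤ ∫⁻ b, liminf (fun n => ∫⁻ s, Φ n (b, s) ∂m) atTop ∂l :=
          lintegral_mono fun b => lintegral_liminf_le fun n => (hΦm n).comp measurable_prodMk_left
      _ ≤ liminf (fun n => ∫⁻ b, ∫⁻ s, Φ n (b, s) ∂m ∂l) atTop :=
          lintegral_liminf_le fun n => (hΦm n).lintegral_prod_right'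
      _ ≤ C := by
          refine liminf_le_of_le (by isBoundedDefault) fun c hc => ?_
          obtain ⟨n, hn⟩ := hc.exists
          exact hn.trans (hbound n)
  have hae : ∀ᵐ b ∂l, ∫⁻ s, liminf (fun n => Φ n (b, s)) atTop ∂m < ∞ := by
    refine ae_lt_top ?_ (ne_top_of_le_ne_top hC hfatou)
    exact (Measurable.liminf hΦm).lintegral_prod_right'
  filter_upwards [hae] with b hb
  have : IsFiniteMeasure (m.map (F b)) := Measure.isFiniteMeasure_map m (F b)
  refine absolutelyContinuous_of_lintegral_liminf hα hr hr0 (ne_top_of_le_ne_top hb.ne ?_)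
  refine (lintegral_map_le _ _).trans (le_of_eq (lintegral_congr fun s => ?_))
  simp only [hΦ, Real.volume_closedBall]
  congr 1
  ext n
  rw [Measure.map_apply (hFb b) Metric.isClosed_closedBall.measurableSet]
  congr 3
  ext t
  simp [Real.dist_eq, abs_sub_comm]

/-! ### An energy estimate over symbolic sequences -/

/-- The cylinder of sequences that agree with `s` before time `n`. -/
def agreeBefore (n : ℕ) (s : ℕ → Fin 2) : Set (ℕ → Fin 2) := {t | ∀ k < n, t k = s k}

lemma measurableSet_agreeBefore_prod (n : ℕ) :
    MeasurableSet {z : (ℕ → Fin 2) × (ℕ → Fin 2) | z.2 ∈ agreeBefore n z.1} := by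
  have : {z : (ℕ → Fin 2) × (ℕ → Fin 2) | z.2 ∈ agreeBefore n z.1} =
      ⋂ k ∈ Finset.range n, {z | z.2 k = z.1 k} := by
    ext z; simp [agreeBefore]
  rw [this]
  refine Finset.measurableSet_biInter _ fun k _ => measurableSet_eq_fun ?_ ?_
  · exact (measurable_pi_apply k).comp measurable_snd
  · exact (measurable_pi_apply k).comp measurable_fst

lemma measurableSet_agreeBefore (n : ℕ) (s : ℕ → Fin 2) : MeasurableSet (agreeBefore n s) :=
  measurable_prodMk_left (measurableSet_agreeBefore_prod n)

lemma measurable_measure_agreeBefore (m : Measure (ℕ → Fin 2)) [SFinite m] (n : ℕ) :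
    Measurable fun s => m (agreeBefore n s) :=
  measurable_measure_prodMk_left (measurableSet_agreeBefore_prod n)

lemma exists_first_difference {s t : ℕ → Fin 2} (h : t ≠ s) :
    ∃ n, t ∈ agreeBefore n s ∧ t n ≠ s n := by
  classical
  have hex : ∃ n, t n ≠ s n := by
    by_contra! hc
    exact h (funext hc)
  exact ⟨Nat.find hex, fun k hk => not_not.1 (Nat.find_min hex hk), Nat.find_spec hex⟩

/-- If the parameters at which two points whose codings first differ at time `n` are `r`-close
have measure at most `r * w n`, then the averaged energy at scale `r` is controlled by the
cylinder measures. -/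
lemma lintegral_energy_le {B : Type*} [MeasurableSpace B] {l : Measure B} [SFinite l]
    (hl : l Set.univ ≤ 1) {m : Measure (ℕ → Fin 2)} [IsFiniteMeasure m]
    {F : B → (ℕ → Fin 2) → ℝ} (hF : Measurable (Function.uncurry F)) {α : ℝ} (hα : 0 < α)
    (hα1 : α ≤ 1) {r : ℝ} {R : ℝ≥0∞} (hR : R ≠ ∞)
    {w : ℕ → (ℕ → Fin 2) → ℝ≥0∞}
    (hm : ∀ᵐ s ∂m, m {s} = 0)
    (h : ∀ᵐ s ∂m, ∀ᵐ t ∂m, ∀ n, t ∈ agreeBefore n s → t n ≠ s n →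
      l {b | |F b s - F b t| ≤ r} ≤ R * w n s) :
    ∫⁻ b, ∫⁻ s, m {t | |F b s - F b t| ≤ r} ^ α ∂m ∂l ≤
      R ^ α * ∫⁻ s, ∑' n, (m (agreeBefore n s) * w n s) ^ α ∂m := by
  have hS : MeasurableSet {z : (B × (ℕ → Fin 2)) × (ℕ → Fin 2) |
      |F z.1.1 z.1.2 - F z.1.1 z.2| ≤ r} := by
    refine measurableSet_le (Measurable.abs (Measurable.sub ?_ ?_)) measurable_const
    · exact hF.comp measurable_fst
    · exact hF.comp ((measurable_fst.comp measurable_fst).prodMk measurable_snd)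
  rw [lintegral_lintegral_swap
    (((measurable_measure_prodMk_left hS).pow_const α).aemeasurable)]
  rw [← lintegral_const_mul' _ _ (ENNReal.rpow_ne_top_of_nonneg hα.le hR)]
  refine lintegral_mono_ae ?_
  filter_upwards [hm, h] with s hs hst
  obtain ⟨D, hD⟩ : ∃ D : ℕ → Set (ℕ → Fin 2), D = fun n => {t | t ∈ agreeBefore n s ∧ t n ≠ s n} :=
    ⟨_, rfl⟩
  have hDm : ∀ n, MeasurableSet (D n) := by
    intro n
    rw [hD]
    refine (measurableSet_agreeBefore n s).inter ?_
    have hn : Measurable fun t : ℕ → Fin 2 => t n := measurable_pi_apply n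
    exact (hn (measurableSet_singleton (s n))).compl
  have hE : ∀ n, MeasurableSet {z : B × (ℕ → Fin 2) | |F z.1 s - F z.1 z.2| ≤ r ∧ z.2 ∈ D n} := by
    intro n
    refine MeasurableSet.inter ?_ (measurable_snd (hDm n))
    have : Measurable fun z : B × (ℕ → Fin 2) => ((z.1, s), z.2) :=
      (measurable_fst.prodMk measurable_const).prodMk measurable_snd
    exact this hS
  have hsplit : ∀ b, m {t | |F b s - F b t| ≤ r} ^ α ≤
      ∑' n, m {t | |F b s - F b t| ≤ r ∧ t ∈ D n} ^ α := by
    intro b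
    refine le_trans ?_ (ENNReal.tsum_rpow_le_tsum_rpow _ hα hα1)
    gcongr
    have hsub : {t | |F b s - F b t| ≤ r} ⊆
        {s} ∪ ⋃ n, {t | |F b s - F b t| ≤ r ∧ t ∈ D n} := by
      intro t ht
      by_cases hts : t = s
      · exact Or.inl hts
      · obtain ⟨n, hn⟩ := exists_first_difference hts
        refine Or.inr (Set.mem_iUnion.2 ⟨n, ht, ?_⟩)
        rw [hD]; exact hn
    refine (measure_mono hsub).trans ((measure_union_le _ _).trans ?_)
    rw [hs, zero_add]
    exact measure_iUnion_le _
  calc ∫⁻ b, m {t | |F b s - F b t| ≤ r} ^ α ∂l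
      ≤ ∫⁻ b, ∑' n, m {t | |F b s - F b t| ≤ r ∧ t ∈ D n} ^ α ∂l := lintegral_mono hsplit
    _ = ∑' n, ∫⁻ b, m {t | |F b s - F b t| ≤ r ∧ t ∈ D n} ^ α ∂l :=
        lintegral_tsum fun n => ((measurable_measure_prodMk_left (hE n)).pow_const α).aemeasurable
    _ ≤ ∑' n, R ^ α * (m (agreeBefore n s) * w n s) ^ α := by
        refine ENNReal.tsum_le_tsum fun n => ?_
        rw [← ENNReal.mul_rpow_of_nonneg _ _ hα.le]
        refine (lintegral_rpow_le_rpow_lintegral hl (measurable_measure_prodMk_left (hE n)) hα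
          hα1).trans ?_
        gcongr
        -- Fubini turns the average over `b` of the measure of close `t` into the integral over `t`
        -- of the measure of good `b`.
        have e1 := Measure.prod_apply (μ := l) (ν := m) (hE n)
        have e2 := Measure.prod_apply_symm (μ := l) (ν := m) (hE n)
        refine (e1.symm.trans e2).trans_le ?_
        calc _ ≤ ∫⁻ t, (D n).indicator (fun _ => R * w n s) t ∂m := by
              refine lintegral_mono_ae ?_
              filter_upwards [hst] with t ht
              by_cases htD : t ∈ D n
              · rw [Set.indicator_of_mem htD]
                rw [hD] at htD
                exact (measure_mono fun b hb => hb.1).trans (ht n htD.1 htD.2)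
              · simp [htD]
          _ ≤ R * w n s * m (D n) := by rw [lintegral_indicator_const (hDm n)]
          _ ≤ R * w n s * m (agreeBefore n s) := by
              gcongr
              rw [hD]
              exact fun t ht => ht.1
          _ = R * (m (agreeBefore n s) * w n s) := by ring
    _ = R ^ α * ∑' n, (m (agreeBefore n s) * w n s) ^ α := ENNReal.tsum_mul_left

/-! ### Cylinder sums of a Markov measure -/

lemma mem_agreeBefore_self (n : ℕ) (s : ℕ → Fin 2) : s ∈ agreeBefore n s := fun _ _ => rfl

lemma agreeBefore_congr {n : ℕ} {s t : ℕ → Fin 2} (h : t ∈ agreeBefore n s) :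
    agreeBefore n t = agreeBefore n s := by
  ext z
  exact forall₂_congr fun k hk => by rw [h k hk]

lemma countOnes_congr {n : ℕ} {s t : ℕ → Fin 2} (h : t ∈ agreeBefore n s) :
    countOnes t n = countOnes s n :=
  Finset.sum_congr rfl fun k hk => by rw [h k (Finset.mem_range.1 hk)]

/-- The extension by zero of a finite zero-one word. -/
def extendZero {n : ℕ} (u : Fin n → Fin 2) : ℕ → Fin 2 :=
  fun k => if h : k < n then u ⟨k, h⟩ else 0

lemma extendZero_restrict_mem (n : ℕ) (s : ℕ → Fin 2) :
    s ∈ agreeBefore n (extendZero fun k : Fin n => s k) := by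
  intro k hk
  simp [extendZero, hk]

lemma extendZero_snoc_mem {n : ℕ} (u : Fin n → Fin 2) (b : Fin 2) :
    extendZero (Fin.snoc u b : Fin (n + 1) → Fin 2) ∈ agreeBefore n (extendZero u) := by
  intro k hk
  simp [extendZero, hk, Nat.lt_succ_of_lt hk, Fin.snoc]

lemma extendZero_snoc_last {n : ℕ} (u : Fin n → Fin 2) (b : Fin 2) :
    extendZero (Fin.snoc u b : Fin (n + 1) → Fin 2) n = b := by
  simp [extendZero, Fin.snoc]

/-- The integral of a function of the first `n` coordinates is a sum over words. -/
lemma lintegral_eq_sum_words (m : Measure (ℕ → Fin 2)) {n : ℕ} {g : (ℕ → Fin 2) → ℝ≥0∞}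
    (hg : ∀ s t, t ∈ agreeBefore n s → g t = g s) :
    ∫⁻ s, g s ∂m = ∑ u : Fin n → Fin 2, g (extendZero u) * m (agreeBefore n (extendZero u)) := by
  have h : ∀ s, g s = ∑ u : Fin n → Fin 2,
      (agreeBefore n (extendZero u)).indicator (fun _ => g (extendZero u)) s := by
    intro s
    rw [Finset.sum_eq_single (fun k : Fin n => s k)]
    · rw [Set.indicator_of_mem (extendZero_restrict_mem n s)]
      exact hg _ _ (extendZero_restrict_mem n s)
    · intro u _ hu
      refine Set.indicator_of_notMem (fun hs => hu ?_) _
      funext k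
      have := hs k k.2
      simpa [extendZero] using this.symm
    · simp
  rw [lintegral_congr h, lintegral_finsetSum _ fun u _ =>
    measurable_const.indicator (measurableSet_agreeBefore _ _)]
  exact Finset.sum_congr rfl fun u _ =>
    lintegral_indicator_const (measurableSet_agreeBefore _ _) _

/-- A measure on sequences has Markov cylinder measures with transition matrix `M`. -/
def HasMarkovCylinders (M : Matrix (Fin 2) (Fin 2) ℝ) (m : Measure (ℕ → Fin 2)) : Prop :=
  ∀ n s, m.real (agreeBefore (n + 2) s) = m.real (agreeBefore (n + 1) s) * M (s n) (s (n + 1))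

/-- The weighted `q`-th power of a cylinder measure. -/
noncomputable def cylinderWeight (m : Measure (ℕ → Fin 2)) (α a c : ℝ) (n : ℕ)
    (s : ℕ → Fin 2) : ℝ :=
  m.real (agreeBefore n s) ^ (1 + α) * ((c ^ countOnes s n * a ^ n)⁻¹) ^ α

lemma cylinderWeight_congr (m : Measure (ℕ → Fin 2)) (α a c : ℝ) {n : ℕ} {s t : ℕ → Fin 2}
    (h : t ∈ agreeBefore n s) : cylinderWeight m α a c n t = cylinderWeight m α a c n s := by
  rw [cylinderWeight, cylinderWeight, agreeBefore_congr h, countOnes_congr h]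

/-- The total weight of the words of length `n + 1` ending in `j`. -/
noncomputable def wordSum (m : Measure (ℕ → Fin 2)) (α a c : ℝ) (j : Fin 2) (n : ℕ) : ℝ :=
  ∑ u : Fin (n + 1) → Fin 2, if extendZero u n = j then cylinderWeight m α a c (n + 1)
    (extendZero u) else 0

lemma cylinderWeight_nonneg (m : Measure (ℕ → Fin 2)) {α a c : ℝ} (ha : 0 < a) (hc : 0 < c)
    (n : ℕ) (s : ℕ → Fin 2) : 0 ≤ cylinderWeight m α a c n s := by
  unfold cylinderWeight; positivity

lemma wordSum_nonneg (m : Measure (ℕ → Fin 2)) {α a c : ℝ} (ha : 0 < a) (hc : 0 < c)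
    (j : Fin 2) (n : ℕ) : 0 ≤ wordSum m α a c j n :=
  Finset.sum_nonneg fun u _ => by
    split_ifs
    · exact cylinderWeight_nonneg m ha hc _ _
    · exact le_rfl

lemma cylinderWeight_succ {M : Matrix (Fin 2) (Fin 2) ℝ} {m : Measure (ℕ → Fin 2)}
    (hm : HasMarkovCylinders M m) (hM : ∀ i j, 0 ≤ M i j) {α a c : ℝ} (ha : 0 < a) (hc : 0 < c)
    (n : ℕ) (s : ℕ → Fin 2) :
    cylinderWeight m α a c (n + 2) s = cylinderWeight m α a c (n + 1) s *
      (M (s n) (s (n + 1)) ^ (1 + α) * ((c ^ (s (n + 1) : ℕ) * a)⁻¹) ^ α) := by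
  have e1 : countOnes s (n + 2) = countOnes s (n + 1) + s (n + 1) := Finset.sum_range_succ _ _
  rw [cylinderWeight, cylinderWeight, hm, Real.mul_rpow (by positivity) (hM _ _), e1, pow_add,
    pow_succ a (n + 1), mul_mul_mul_comm, mul_inv (c ^ _ * _), Real.mul_rpow (by positivity)
    (by positivity)]
  ring

/-- The weight is multiplicative along the chain, so splitting off the last letter gives a transfer
matrix acting on the two word sums. -/
lemma wordSum_succ {M : Matrix (Fin 2) (Fin 2) ℝ} {m : Measure (ℕ → Fin 2)}
    (hm : HasMarkovCylinders M m) (hM : ∀ i j, 0 ≤ M i j) {α a c : ℝ} (ha : 0 < a) (hc : 0 < c)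
    (j : Fin 2) (n : ℕ) :
    wordSum m α a c j (n + 1) =
      ∑ i, wordSum m α a c i n * (M i j ^ (1 + α) * ((c ^ (j : ℕ) * a)⁻¹) ^ α) := by
  have h : wordSum m α a c j (n + 1) = ∑ u : Fin (n + 1) → Fin 2,
      cylinderWeight m α a c (n + 1) (extendZero u) *
        (M (extendZero u n) j ^ (1 + α) * ((c ^ (j : ℕ) * a)⁻¹) ^ α) := by
    rw [wordSum, ← Equiv.sum_comp (Fin.snocEquiv fun _ => Fin 2), Fintype.sum_prod_type,
      Finset.sum_eq_single j]
    · refine Finset.sum_congr rfl fun u _ => ?_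
      have hmem := extendZero_snoc_mem u j
      change (if extendZero (Fin.snoc u j : Fin (n + 1 + 1) → Fin 2) (n + 1) = j then
        cylinderWeight m α a c (n + 2) (extendZero (Fin.snoc u j : Fin (n + 1 + 1) → Fin 2))
        else 0) = _
      rw [extendZero_snoc_last, if_pos rfl, cylinderWeight_succ hm hM ha hc,
        cylinderWeight_congr _ _ _ _ hmem, extendZero_snoc_last, hmem n (Nat.lt_succ_self n)]
    · intro b _ hb
      refine Finset.sum_eq_zero fun u _ => ?_
      change (if extendZero (Fin.snoc u b : Fin (n + 1 + 1) → Fin 2) (n + 1) = j then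
        cylinderWeight m α a c (n + 2) (extendZero (Fin.snoc u b : Fin (n + 1 + 1) → Fin 2))
        else 0) = _
      rw [extendZero_snoc_last, if_neg hb]
    · simp
  rw [h]
  simp only [wordSum, Finset.sum_mul]
  rw [Finset.sum_comm]
  refine Finset.sum_congr rfl fun u _ => ?_
  rw [Finset.sum_eq_single (extendZero u n)]
  · simp
  · intro i _ hi
    rw [if_neg hi.symm, zero_mul]
  · simp

/-- A linear recursion of order two with small coefficients has summable solutions. -/
lemma summable_of_recursion {x : ℕ → ℝ} {A B : ℝ} (hx : ∀ n, 0 ≤ x n) (hA : 0 ≤ A) (hB : 0 ≤ B)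
    (hAB : A + B < 1) (h : ∀ n, x (n + 2) = A * x (n + 1) + B * x n) : Summable x := by
  refine summable_of_sum_range_le (c := (x 0 + x 1) / (1 - (A + B))) hx fun n => ?_
  have hs : ∀ n, ∑ i ∈ Finset.range n, x i ≤ ∑ i ∈ Finset.range (n + 1), x i := fun n => by
    rw [Finset.sum_range_succ]; linarith [hx n]
  -- Summing the recursion bounds each partial sum by earlier ones; monotonicity then allows
  -- absorbing them with factor `A + B < 1`.
  have key : ∀ n, ∑ i ∈ Finset.range (n + 2), x i ≤
      x 0 + x 1 + A * ∑ i ∈ Finset.range (n + 1), x i + B * ∑ i ∈ Finset.range n, x i := by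
    intro n
    induction n with
    | zero => simp [Finset.sum_range_succ]; nlinarith [mul_nonneg hA (hx 0)]
    | succ n ih =>
      have eA : A * ∑ i ∈ Finset.range (n + 1 + 1), x i =
          A * ∑ i ∈ Finset.range (n + 1), x i + A * x (n + 1) := by
        rw [Finset.sum_range_succ, mul_add]
      have eB : B * ∑ i ∈ Finset.range (n + 1), x i =
          B * ∑ i ∈ Finset.range n, x i + B * x n := by
        rw [Finset.sum_range_succ, mul_add]
      rw [show n + 1 + 2 = n + 2 + 1 by ring, Finset.sum_range_succ, h n]
      linarith
  have h1 := key n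
  have h2 := hs n
  have h3 := hs (n + 1)
  rw [le_div_iff₀ (by linarith)]
  nlinarith [mul_le_mul_of_nonneg_left h3 hA, mul_le_mul_of_nonneg_left (h2.trans h3) hB]

lemma transitionMatrix_nonneg {p : ℝ} (hp : p ∈ Set.Ioo (0 : ℝ) 1) (i j : Fin 2) :
    0 ≤ transitionMatrix p i j := by
  have := hp.1.le
  have := hp.2.le
  fin_cases i <;> fin_cases j <;> simp [transitionMatrix] <;> linarith

/-- A one can only follow a zero, so the sum over words ending in one is a multiple of the previous
sum over words ending in zero. Eliminating it leaves a second-order recursion. -/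
lemma summable_wordSum {p α a c : ℝ} (hp : p ∈ Set.Ioo (0 : ℝ) 1) (hα : 0 < α) (ha : 0 < a)
    (hc : 0 < c) (h : p ^ (1 + α) / a ^ α + (1 - p) ^ (1 + α) / (c * a ^ 2) ^ α < 1)
    {m : Measure (ℕ → Fin 2)} (hm : HasMarkovCylinders (transitionMatrix p) m) (j : Fin 2) :
    Summable (wordSum m α a c j) := by
  have hp0 := hp.1.le
  have hp1 : 0 ≤ 1 - p := by linarith [hp.2]
  have hM := transitionMatrix_nonneg hp
  have h0 : ∀ n, wordSum m α a c 0 (n + 1) = wordSum m α a c 0 n * (p ^ (1 + α) * (a⁻¹) ^ α)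
      + wordSum m α a c 1 n * (a⁻¹) ^ α := by
    intro n
    rw [wordSum_succ hm hM ha hc]
    simp [Fin.sum_univ_two, transitionMatrix]
  have h1 : ∀ n, wordSum m α a c 1 (n + 1) =
      wordSum m α a c 0 n * ((1 - p) ^ (1 + α) * ((c * a)⁻¹) ^ α) := by
    intro n
    rw [wordSum_succ hm hM ha hc]
    have : (1 + α) ≠ 0 := by linarith
    simp [Fin.sum_univ_two, transitionMatrix, Real.zero_rpow this]
  have hs0 : Summable (wordSum m α a c 0) := by
    refine summable_of_recursion (wordSum_nonneg m ha hc 0) (by positivity) (by positivity) h ?_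
    intro n
    rw [h0, h1, Real.inv_rpow ha.le, Real.inv_rpow (by positivity),
      show c * a ^ 2 = (c * a) * a by ring, Real.mul_rpow (x := c * a) (by positivity) ha.le]
    field_simp
  fin_cases j
  · exact hs0
  · refine (summable_nat_add_iff 1).1 ?_
    simp only [Fin.mk_one, h1]
    exact hs0.mul_right _

lemma measurable_cylinder_term (m : Measure (ℕ → Fin 2)) [SFinite m] (α a c : ℝ) (n : ℕ) :
    Measurable fun s => (m (agreeBefore n s) *
      ENNReal.ofReal ((c ^ countOnes s n * a ^ n)⁻¹)) ^ α := by
  have hcount : Measurable fun s : ℕ → Fin 2 => countOnes s n :=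
    Finset.measurable_fun_sum _ fun k _ => by fun_prop
  have : Measurable fun s : ℕ → Fin 2 => (c ^ countOnes s n * a ^ n)⁻¹ :=
    (measurable_from_nat (f := fun k => (c ^ k * a ^ n)⁻¹)).comp hcount
  exact ((measurable_measure_agreeBefore m n).mul this.ennreal_ofReal).pow_const α

/-- The energy series of the Markov measure converges. -/
lemma tsum_lintegral_cylinder_ne_top {p α a c : ℝ} (hp : p ∈ Set.Ioo (0 : ℝ) 1) (hα : 0 < α)
    (ha : 0 < a) (hc : 0 < c)
    (h : p ^ (1 + α) / a ^ α + (1 - p) ^ (1 + α) / (c * a ^ 2) ^ α < 1)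
    {m : Measure (ℕ → Fin 2)} [IsProbabilityMeasure m]
    (hm : HasMarkovCylinders (transitionMatrix p) m) :
    ∫⁻ s, ∑' n, (m (agreeBefore n s) *
      ENNReal.ofReal ((c ^ countOnes s n * a ^ n)⁻¹)) ^ α ∂m ≠ ∞ := by
  have hterm : ∀ n, ∫⁻ s, (m (agreeBefore n s) *
      ENNReal.ofReal ((c ^ countOnes s n * a ^ n)⁻¹)) ^ α ∂m =
      ENNReal.ofReal (∑ u : Fin n → Fin 2, cylinderWeight m α a c n (extendZero u)) := by
    -- Integrating a function of the first `n` letters adds one more factor of the cylinder measure,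
    -- hence the exponent `1 + α`.
    intro n
    rw [lintegral_eq_sum_words m (n := n)
      (fun s t hst => by rw [agreeBefore_congr hst, countOnes_congr hst]),
      ENNReal.ofReal_sum_of_nonneg fun u _ => cylinderWeight_nonneg m ha hc _ _]
    refine Finset.sum_congr rfl fun u _ => ?_
    rw [cylinderWeight, ENNReal.ofReal_mul (by positivity),
      ← ENNReal.ofReal_rpow_of_nonneg (by positivity) hα.le,
      ← ENNReal.ofReal_rpow_of_nonneg (by positivity) (by positivity), ofReal_measureReal,
      ENNReal.mul_rpow_of_nonneg _ _ hα.le, ENNReal.rpow_add_of_nonneg _ _ zero_le_one hα.le,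
      ENNReal.rpow_one]
    ring
  rw [lintegral_tsum fun n => (measurable_cylinder_term m α a c n).aemeasurable]
  simp_rw [hterm]
  have hsum : Summable fun n => ∑ u : Fin n → Fin 2, cylinderWeight m α a c n (extendZero u) := by
    refine (summable_nat_add_iff 1).1 (((summable_wordSum hp hα ha hc h hm 0).add
      (summable_wordSum hp hα ha hc h hm 1)).congr fun n => ?_)
    rw [wordSum, wordSum, ← Finset.sum_add_distrib]
    refine Finset.sum_congr rfl fun u _ => ?_
    rcases Fin.exists_fin_two.1 ⟨extendZero u n, rfl⟩ with hu | hu <;> simp [hu]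
  rw [← ENNReal.ofReal_tsum_of_nonneg
    (fun n => Finset.sum_nonneg fun u _ => cylinderWeight_nonneg m ha hc _ _) hsum]
  exact ENNReal.ofReal_ne_top

/-! ### The coding map -/

/-- Zero-one sequences without two adjacent ones. -/
def NoAdjacentOnes (s : ℕ → Fin 2) : Prop := ∀ n, s n = 0 ∨ s (n + 1) = 0

lemma countOnes_succ (s : ℕ → Fin 2) (n : ℕ) : countOnes s (n + 1) = countOnes s n + s n :=
  Finset.sum_range_succ _ _

lemma countOnes_mono (s : ℕ → Fin 2) : Monotone (countOnes s) :=
  monotone_nat_of_le_succ fun n => by rw [countOnes_succ]; omega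

lemma countOnes_le (s : ℕ → Fin 2) (n : ℕ) : countOnes s n ≤ n := by
  induction n with
  | zero => simp [countOnes]
  | succ n ih => rw [countOnes_succ]; omega

lemma codingMap_eq (c β : ℝ) (s : ℕ → Fin 2) :
    codingMap β (c * β) s =
      ∑' i, ((s i : ℕ) : ℝ) * c ^ countOnes s (i + 1) * β ^ (i + 1) := by
  refine tsum_congr fun i => ?_
  rw [mul_pow, mul_assoc, mul_assoc, mul_assoc, ← pow_add,
    Nat.add_sub_cancel' (countOnes_le s (i + 1))]

lemma measurable_codingMap (c : ℝ) :
    Measurable (Function.uncurry fun β s => codingMap β (c * β) s) := by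
  have hs : ∀ i, Measurable fun z : ℝ × (ℕ → Fin 2) => z.2 i :=
    fun i => (measurable_pi_apply i).comp measurable_snd
  have hs' : ∀ i, Measurable fun z : ℝ × (ℕ → Fin 2) => (z.2 i : ℕ) :=
    fun i => (Measurable.of_discrete (f := fun a : Fin 2 => (a : ℕ))).comp (hs i)
  have hcount : ∀ n, Measurable fun z : ℝ × (ℕ → Fin 2) => countOnes z.2 n :=
    fun n => Finset.measurable_fun_sum _ fun k _ => hs' k
  have hcast : Measurable (fun n : ℕ => (n : ℝ)) := measurable_from_nat
  refine Measurable.tsum fun i => Measurable.mul (Measurable.mul ?_ ?_) ?_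
  · exact hcast.comp (hs' i)
  · exact (measurable_fst.const_mul c).pow (hcount _)
  · exact measurable_fst.pow (measurable_const.sub (hcount _))

/-- The normalised coefficients of the coding series from time `n` on. -/
noncomputable def tailCoeff (c : ℝ) (n : ℕ) (K : ℕ) (s : ℕ → Fin 2) (j : ℕ) : ℝ :=
  ((s (n + j) : ℕ) : ℝ) * c ^ (countOnes s (n + j + 1) - (K + 1))

lemma isSparse_tailCoeff {c : ℝ} (hc : c ∈ Set.Ioc (0 : ℝ) 1) (n K : ℕ) {s : ℕ → Fin 2}
    (hs : NoAdjacentOnes s) : IsSparse (tailCoeff c n K s) := by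
  have hc0 := hc.1
  have hle : ∀ j, tailCoeff c n K s j ≤ 1 := by
    intro j
    refine mul_le_one₀ ?_ (by positivity) (pow_le_one₀ hc0.le hc.2)
    exact_mod_cast Nat.lt_succ_iff.1 (s (n + j)).2
  refine ⟨fun j => by unfold tailCoeff; positivity, fun j => ?_⟩
  rcases hs (n + j) with h | h
  · have : tailCoeff c n K s j = 0 := by simp [tailCoeff, h]
    linarith [hle (j + 1)]
  · have : tailCoeff c n K s (j + 1) = 0 := by simp [tailCoeff, ← add_assoc, h]
    linarith [hle j]

/-- The truncated subtraction in `tailCoeff` is harmless: if the digit is one, the count is already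
at least `K + 1`; otherwise both sides vanish. -/
lemma coeff_eq_tailCoeff {c : ℝ} {n K : ℕ} {s : ℕ → Fin 2} (hK : countOnes s n = K) (j : ℕ) :
    ((s (n + j) : ℕ) : ℝ) * c ^ countOnes s (n + j + 1) = c ^ (K + 1) * tailCoeff c n K s j := by
  rcases Fin.exists_fin_two.1 ⟨s (n + j), rfl⟩ with h | h
  · simp [tailCoeff, h]
  · have h1 : K + 1 ≤ countOnes s (n + j + 1) := by
      rw [countOnes_succ, h, ← hK]
      exact Nat.add_le_add_right (countOnes_mono s (Nat.le_add_right _ _)) 1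
    simp only [tailCoeff, h]
    rw [mul_left_comm, ← pow_add, Nat.add_sub_cancel' h1]

/-- The difference of two coding series is a sparse power series, up to a scaling. -/
lemma codingMap_sub {c β : ℝ} (hc : c ∈ Set.Ioc (0 : ℝ) 1) (hβ : 0 ≤ β) (hβ1 : β < 1)
    {s t : ℕ → Fin 2} {n : ℕ} (hst : t ∈ agreeBefore n s) :
    codingMap β (c * β) s - codingMap β (c * β) t = c ^ (countOnes s n + 1) * β ^ (n + 1) *
      ∑' j, (tailCoeff c n (countOnes s n) s j - tailCoeff c n (countOnes s n) t j) * β ^ j := by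
  have hc0 := hc.1
  have hsum : ∀ u : ℕ → Fin 2, Summable fun i =>
      ((u i : ℕ) : ℝ) * c ^ countOnes u (i + 1) * β ^ (i + 1) := by
    intro u
    refine Summable.of_nonneg_of_le (fun i => by positivity) (fun i => ?_)
      ((summable_nat_add_iff 1).2 (summable_geometric_of_lt_one hβ hβ1))
    refine mul_le_of_le_one_left (by positivity)
      (mul_le_one₀ ?_ (by positivity) (pow_le_one₀ hc0.le hc.2))
    exact_mod_cast Nat.lt_succ_iff.1 (u i).2
  rw [codingMap_eq, codingMap_eq, ← (hsum s).sum_add_tsum_nat_add n,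
    ← (hsum t).sum_add_tsum_nat_add n]
  have hhead : ∑ i ∈ Finset.range n, ((t i : ℕ) : ℝ) * c ^ countOnes t (i + 1) * β ^ (i + 1) =
      ∑ i ∈ Finset.range n, ((s i : ℕ) : ℝ) * c ^ countOnes s (i + 1) * β ^ (i + 1) := by
    refine Finset.sum_congr rfl fun i hi => ?_
    have hi' := Finset.mem_range.1 hi
    rw [hst i hi', countOnes_congr (n := i + 1) fun k hk => hst k (by omega)]
  rw [hhead, add_sub_add_left_eq_sub,
    ← ((summable_nat_add_iff n).2 (hsum s)).tsum_sub ((summable_nat_add_iff n).2 (hsum t)),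
    ← tsum_mul_left]
  refine tsum_congr fun j => ?_
  rw [add_comm j n, coeff_eq_tailCoeff rfl, coeff_eq_tailCoeff (countOnes_congr hst)]
  ring

lemma tailCoeff_zero_of_one {c : ℝ} {n : ℕ} {s : ℕ → Fin 2} (h : s n = 1) :
    tailCoeff c n (countOnes s n) s 0 = 1 := by
  simp [tailCoeff, h, countOnes_succ]

lemma tailCoeff_zero_of_zero {c : ℝ} {n K : ℕ} {s : ℕ → Fin 2} (h : s n = 0) :
    tailCoeff c n K s 0 = 0 := by
  simp [tailCoeff, h]

/-- Transversality at scale `r / (c ^ (K + 1) * a ^ (n + 1))`. The extra factors `c` and `a` from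
the `+ 1`, with `a ^ 5` from the sparse estimate, form `c * a ^ 6`. -/
lemma volume_codingMap_sub_le {a c r : ℝ} (ha : 0 < a) (hc : c ∈ Set.Ioc (0 : ℝ) 1) (hr : 0 ≤ r)
    {s t : ℕ → Fin 2} (hs : NoAdjacentOnes s) (ht : NoAdjacentOnes t) {n : ℕ}
    (hst : t ∈ agreeBefore n s) (hn : t n ≠ s n) :
    (volume.restrict (Set.Ioo a 0.739))
        {β : ℝ | |codingMap β (c * β) s - codingMap β (c * β) t| ≤ r} ≤
      ENNReal.ofReal (200 / (c * a ^ 6) * r) *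
        ENNReal.ofReal ((c ^ countOnes s n * a ^ n)⁻¹) := by
  have hc0 := hc.1
  wlog h1 : s n = 1 generalizing s t
  · have hs0 : s n = 0 := by
      by_contra h
      exact h1 (Fin.eq_one_of_ne_zero _ h)
    have ht1 : t n = 1 := Fin.eq_one_of_ne_zero _ (hs0 ▸ hn)
    have := this ht hs (fun k hk => (hst k hk).symm) hn.symm ht1
    simp_rw [abs_sub_comm (codingMap _ _ s)]
    rwa [countOnes_congr hst] at this
  have ht0 : t n = 0 := by
    by_contra h
    exact hn ((Fin.eq_one_of_ne_zero _ h).trans h1.symm)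
  obtain ⟨K, hK⟩ : ∃ K, K = countOnes s n := ⟨_, rfl⟩
  rw [Measure.restrict_apply' measurableSet_Ioo, ← ENNReal.ofReal_mul (by positivity)]
  have hsub : {β : ℝ | |codingMap β (c * β) s - codingMap β (c * β) t| ≤ r} ∩ Set.Ioo a 0.739 ⊆
      {β : ℝ | β ∈ Set.Ioo a 0.739 ∧ |∑' j, (tailCoeff c n K s j - tailCoeff c n K t j) * β ^ j| ≤
        r / (c ^ (K + 1) * a ^ (n + 1))} := by
    rintro β ⟨hβr, hβ⟩
    refine ⟨hβ, ?_⟩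
    have hβ0 : 0 < β := ha.trans hβ.1
    have hβr : |codingMap β (c * β) s - codingMap β (c * β) t| ≤ r := hβr
    rw [codingMap_sub hc hβ0.le (hβ.2.trans (by norm_num)) hst, ← hK, abs_mul,
      abs_of_pos (by positivity)] at hβr
    rw [le_div_iff₀ (by positivity), mul_comm]
    refine le_trans ?_ hβr
    gcongr
    exact hβ.1.le
  refine (measure_mono hsub).trans ((volume_sparse_le (isSparse_tailCoeff hc n K hs)
    (isSparse_tailCoeff hc n K ht) (hK ▸ tailCoeff_zero_of_one h1) (tailCoeff_zero_of_zero ht0) ha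
    (by positivity)).trans (le_of_eq ?_))
  rw [← hK, pow_succ c, pow_succ a]
  congr 1
  field_simp

/-! ### Absolute continuity for almost every parameter -/

/-- The transition from one to one has probability zero, and the event depends on finitely many
letters. -/
lemma ae_noAdjacentOnes {p : ℝ} {m : Measure (ℕ → Fin 2)} [IsFiniteMeasure m]
    (hm : HasMarkovCylinders (transitionMatrix p) m) : ∀ᵐ s ∂m, NoAdjacentOnes s := by
  refine ae_all_iff.2 fun n => ?_
  have hmeas : MeasurableSet {s : ℕ → Fin 2 | ¬(s n = 0 ∨ s (n + 1) = 0)} := by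
    have h : ∀ k, MeasurableSet {s : ℕ → Fin 2 | s k = 0} := fun k =>
      measurableSet_eq_fun (measurable_pi_apply k) measurable_const
    exact ((h n).union (h (n + 1))).compl
  rw [ae_iff, ← lintegral_indicator_one hmeas, lintegral_eq_sum_words m (n := n + 2)]
  · refine Finset.sum_eq_zero fun u _ => ?_
    obtain ⟨s, hs⟩ : ∃ s, s = extendZero u := ⟨_, rfl⟩
    rw [← hs]
    by_cases h : s n = 0 ∨ s (n + 1) = 0
    · have h' : s ∉ {s : ℕ → Fin 2 | ¬(s n = 0 ∨ s (n + 1) = 0)} := fun h' => h' h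
      rw [Set.indicator_of_notMem h', zero_mul]
    · push Not at h
      have h0 := hm n s
      rw [Fin.eq_one_of_ne_zero _ h.1, Fin.eq_one_of_ne_zero _ h.2] at h0
      have h1 : m.real (agreeBefore (n + 2) s) = 0 := by simpa [transitionMatrix] using h0
      rw [measureReal_eq_zero_iff] at h1
      rw [h1, mul_zero]
  · intro s t hst
    simp only [Set.indicator, Set.mem_ofPred_eq, hst n (by omega), hst (n + 1) (by omega),
      Pi.one_apply]

/-- Almost everywhere the series converges, so its terms tend to zero, yet each is at least `m {s} ^
α`. -/
lemma ae_measure_singleton_eq_zero {m : Measure (ℕ → Fin 2)} {α : ℝ} (hα : 0 < α)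
    {w : ℕ → (ℕ → Fin 2) → ℝ≥0∞} (hw : ∀ n s, 1 ≤ w n s)
    (hmeas : AEMeasurable (fun s => ∑' n, (m (agreeBefore n s) * w n s) ^ α) m)
    (h : ∫⁻ s, ∑' n, (m (agreeBefore n s) * w n s) ^ α ∂m ≠ ∞) : ∀ᵐ s ∂m, m {s} = 0 := by
  filter_upwards [ae_lt_top' hmeas h] with s hs
  have hlim := ENNReal.tendsto_atTop_zero_of_tsum_ne_top hs.ne
  have hle : ∀ n, m {s} ^ α ≤ (m (agreeBefore n s) * w n s) ^ α := by
    intro n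
    gcongr
    calc m {s} ≤ m (agreeBefore n s) :=
          measure_mono (Set.singleton_subset_iff.2 (mem_agreeBefore_self n s))
      _ ≤ _ := le_mul_of_one_le_right' (hw n s)
  have h0 : m {s} ^ α = 0 := le_antisymm (ge_of_tendsto' hlim hle) zero_le
  exact (ENNReal.rpow_eq_zero_iff_of_pos hα).1 h0

lemma ae_restrict_map_codingMap {p α a c : ℝ} (hp : p ∈ Set.Ioo (0 : ℝ) 1) (hα : 0 < α)
    (hα1 : α ≤ 1) (ha : 0 < a) (ha1 : a ≤ 1) (hc : c ∈ Set.Ioc (0 : ℝ) 1)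
    (h : p ^ (1 + α) / a ^ α + (1 - p) ^ (1 + α) / (c * a ^ 2) ^ α < 1)
    {m : Measure (ℕ → Fin 2)} [IsProbabilityMeasure m]
    (hm : HasMarkovCylinders (transitionMatrix p) m) :
    ∀ᵐ β ∂(volume.restrict (Set.Ioo a 0.739)), m.map (codingMap β (c * β)) ≪ volume ∧
      ∫⁻ x, ((m.map (codingMap β (c * β))).rnDeriv volume x) ^ (α + 1) ≠ ∞ := by
  have hc0 := hc.1
  have hQ := tsum_lintegral_cylinder_ne_top hp hα ha hc.1 h hm
  have hmeas : Measurable fun s : ℕ → Fin 2 => ∑' n, (m (agreeBefore n s) *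
      ENNReal.ofReal ((c ^ countOnes s n * a ^ n)⁻¹)) ^ α :=
    Measurable.tsum fun n => measurable_cylinder_term m α a c n
  have hsing : ∀ᵐ s ∂m, m {s} = 0 := by
    refine ae_measure_singleton_eq_zero hα (fun n s => ?_) hmeas.aemeasurable hQ
    rw [← ENNReal.ofReal_one]
    refine ENNReal.ofReal_le_ofReal (one_le_inv_iff₀.2 ⟨by positivity, ?_⟩)
    exact mul_le_one₀ (pow_le_one₀ hc0.le hc.2) (by positivity) (pow_le_one₀ ha.le ha1)
  have hl : volume.restrict (Set.Ioo a 0.739) Set.univ ≤ 1 := by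
    rw [Measure.restrict_apply_univ, Real.volume_Ioo, ← ENNReal.ofReal_one]
    exact ENNReal.ofReal_le_ofReal (by linarith)
  obtain ⟨r, hr, hr0⟩ : ∃ r : ℕ → ℝ, (∀ n, 0 < r n) ∧ Tendsto r atTop (𝓝 0) :=
    ⟨fun n => 1 / ((n : ℝ) + 1), fun n => by positivity, tendsto_one_div_add_atTop_nhds_zero_nat⟩
  refine ae_absolutelyContinuous_of_energy_bound (measurable_codingMap c) hα hr hr0
    -- `100` against the ball length `2 * r n` matches `200` against `r n`.
    (C := ENNReal.ofReal (100 / (c * a ^ 6)) ^ α * _)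
    (ENNReal.mul_ne_top (ENNReal.rpow_ne_top_of_nonneg hα.le ENNReal.ofReal_ne_top) hQ)
    fun n => ?_
  refine (lintegral_energy_le hl (measurable_codingMap c) hα hα1
    (R := ENNReal.ofReal (200 / (c * a ^ 6) * r n)) ENNReal.ofReal_ne_top
    (w := fun n s => ENNReal.ofReal ((c ^ countOnes s n * a ^ n)⁻¹)) hsing ?_).trans
    (le_of_eq ?_)
  · filter_upwards [ae_noAdjacentOnes hm] with s hs
    filter_upwards [ae_noAdjacentOnes hm] with t ht
    exact fun k hk hk' => volume_codingMap_sub_le ha hc (hr n).le hs ht hk hk'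
  · rw [mul_right_comm, ← ENNReal.mul_rpow_of_nonneg _ _ hα.le,
      ← ENNReal.ofReal_mul (by positivity)]
    congr 3
    ring

lemma hasMarkovCylinders_map {Ω : Type*} [MeasurableSpace Ω] {P : Measure Ω}
    {ι : Fin 2 → ℝ} {M : Matrix (Fin 2) (Fin 2) ℝ} {X : ℕ → Ω → Fin 2}
    (hX : IsMarkovChain ι M P X) : HasMarkovCylinders M (P.map fun ω n => X n ω) := by
  have hmeas : Measurable fun ω n => X n ω := measurable_pi_lambda _ hX.measurable
  have h : ∀ n s, (P.map fun ω n => X n ω).real (agreeBefore (n + 1) s) =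
      P.real {ω | ∀ k ≤ n, X k ω = s k} := by
    intro n s
    rw [measureReal_def, Measure.map_apply hmeas (measurableSet_agreeBefore _ _), ← measureReal_def]
    congr 1
    ext ω
    simp [agreeBefore]
  intro n s
  exact (h (n + 1) s).trans ((hX.transition n s).trans (by rw [h n s]))

lemma markovGeometricMeasure_eq_map {Ω : Type*} [MeasurableSpace Ω] {P : Measure Ω}
    {X : ℕ → Ω → Fin 2} (hX : ∀ n, Measurable (X n)) (β c : ℝ) :
    markovGeometricMeasure P X β (c * β) =
      (P.map fun ω n => X n ω).map (codingMap β (c * β)) := by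
  have hcod : Measurable (codingMap β (c * β)) :=
    (measurable_codingMap c).comp measurable_prodMk_left
  rw [markovGeometricMeasure, Measure.map_map hcod (measurable_pi_lambda _ hX)]
  rfl

theorem theorem5p1 {Ω : Type*} [MeasurableSpace Ω] (P : Measure Ω) [IsProbabilityMeasure P]
    (p q c : ℝ) (hp : p ∈ Set.Ioo (0 : ℝ) 1) (hq : q ∈ Set.Ioc (1 : ℝ) 2)
    (hc : c ∈ Set.Ioc (0 : ℝ) 1)
    (X : ℕ → Ω → Fin 2) (hX : IsMarkovChain (initialProb p) (transitionMatrix p) P X) :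
    ∀ᵐ β ∂(volume : Measure ℝ), β ∈ Set.Ioo (0 : ℝ) 0.739 →
      p ^ q / β ^ (q - 1) + (1 - p) ^ q / (c * β ^ 2) ^ (q - 1) < 1 →
        markovGeometricMeasure P X β (c * β) ≪ volume ∧
          MemLp (fun x => ((markovGeometricMeasure P X β (c * β)).rnDeriv volume x).toReal)
            (ENNReal.ofReal q) volume := by
  have hmeas : Measurable fun ω n => X n ω := measurable_pi_lambda _ hX.measurable
  have hm := hasMarkovCylinders_map hX
  have hprob : IsProbabilityMeasure (P.map fun ω n => X n ω) :=
    Measure.isProbabilityMeasure_map hmeas.aemeasurable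
  have hq1 : 1 + (q - 1) = q := by ring
  have hc0 := hc.1
  -- Rational left endpoints make the union of exceptional sets countable, hence null.
  have key : ∀ a : ℚ, ∀ᵐ β ∂(volume : Measure ℝ), (0 : ℝ) < a → (a : ℝ) ≤ 1 →
      p ^ q / (a : ℝ) ^ (q - 1) + (1 - p) ^ q / (c * (a : ℝ) ^ 2) ^ (q - 1) < 1 →
      β ∈ Set.Ioo (a : ℝ) 0.739 →
      (P.map fun ω n => X n ω).map (codingMap β (c * β)) ≪ volume ∧
      ∫⁻ x, (((P.map fun ω n => X n ω).map (codingMap β (c * β))).rnDeriv volume x) ^ q ≠ ∞ := by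
    intro a
    by_cases ha : (0 : ℝ) < a ∧ (a : ℝ) ≤ 1 ∧
      p ^ q / (a : ℝ) ^ (q - 1) + (1 - p) ^ q / (c * (a : ℝ) ^ 2) ^ (q - 1) < 1
    · have := ae_restrict_map_codingMap hp (sub_pos.2 hq.1) (by linarith [hq.2]) ha.1 ha.2.1 hc
        (by rw [hq1]; exact ha.2.2) hm
      rw [ae_restrict_iff' measurableSet_Ioo, sub_add_cancel] at this
      filter_upwards [this] with β hβ _ _ _ hmem using hβ hmem
    · exact Eventually.of_forall fun β h1 h2 h3 => absurd ⟨h1, h2, h3⟩ ha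
  filter_upwards [ae_all_iff.2 key] with β hβ hβI hcond
  have hβ0 := hβI.1
  have hcont : ContinuousAt
      (fun a : ℝ => p ^ q / a ^ (q - 1) + (1 - p) ^ q / (c * a ^ 2) ^ (q - 1)) β := by
    have h1 : β ^ (q - 1) ≠ 0 := by positivity
    have h2 : (c * β ^ 2) ^ (q - 1) ≠ 0 := by positivity
    have h3 : ContinuousAt (fun a : ℝ => a ^ (q - 1)) β :=
      Real.continuousAt_rpow_const _ _ (Or.inl hβ0.ne')
    have h4 : ContinuousAt (fun a : ℝ => (c * a ^ 2) ^ (q - 1)) β :=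
      ContinuousAt.rpow_const (by fun_prop) (Or.inl (by positivity))
    exact (continuousAt_const.div h3 h1).add (continuousAt_const.div h4 h2)
  -- The strict condition at `β` persists, by continuity, at some rational `a < β`.
  obtain ⟨a, ha0, haβ, hacond⟩ : ∃ a : ℚ, (0 : ℝ) < a ∧ (a : ℝ) < β ∧
      p ^ q / (a : ℝ) ^ (q - 1) + (1 - p) ^ q / (c * (a : ℝ) ^ 2) ^ (q - 1) < 1 := by
    have hev := hcont.eventually_lt_const hcond
    obtain ⟨ε, hε, hball⟩ := Metric.eventually_nhds_iff.1 hev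
    obtain ⟨a, ha1, ha2⟩ := exists_rat_btwn (show max 0 (β - ε) < β from
      max_lt hβ0 (by linarith))
    refine ⟨a, (le_max_left _ _).trans_lt ha1, ha2, hball ?_⟩
    have := (le_max_right _ _).trans_lt ha1
    rw [Real.dist_eq, abs_lt]
    constructor <;> linarith
  obtain ⟨hac, hint⟩ := hβ a ha0 (haβ.le.trans (hβI.2.le.trans (by norm_num))) hacond ⟨haβ, hβI.2⟩
  rw [markovGeometricMeasure_eq_map hX.measurable]
  have hq0 : 0 < q := by linarith [hq.1]
  refine ⟨hac, (Measure.measurable_rnDeriv _ _).ennreal_toReal.aestronglyMeasurable, ?_⟩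
  rw [eLpNorm_lt_top_iff_lintegral_rpow_enorm_lt_top (by simpa using hq0) ENNReal.ofReal_ne_top,
    ENNReal.toReal_ofReal hq0.le]
  refine lt_of_le_of_lt (lintegral_mono fun x => ?_) hint.lt_top
  gcongr
  rw [Real.enorm_of_nonneg ENNReal.toReal_nonneg]
  exact ENNReal.ofReal_toReal_le
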